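/- Let $k\ge 1$ and let $G=(V,E)$ be any simple graph with vertex set $V=\{1,\ldots,k\}$. For positive integers $n_1,\ldots,n_k$ put $\delta_G(n_1,\ldots,n_k)=1$ if $\gcd(n_i,n_j)=1$ for every edge $\{i,j\}\in E$, and $\delta_G(n_1,\ldots,n_k)=0$ otherwise. Let $d_G$ be the maximum degree of the vertices of $G$, let $\mu(n_1,\ldots,n_k)=\mu(n_1)\cdots\mu(n_k)$ be the Möbius function of $k$ variables, and let $$(f*g)(n_1,\ldots,n_k)=\sum_{d_1\mid n_1,\ldots,d_k\mid n_k} f(d_1,\ldots,d_k)\,g(n_1/d_1,\ldots,n_k/d_k)$$ be the Dirichlet convolution. Then there is a real constant $A_G$ such that, for real $x\ge 2$, $$\sum_{n_1,\ldots,n_k\le x}\delta_G(n_1,\ldots,n_k)=A_G\,x^k+O\bigl(x^{k-1}(\log x)^{d_G}\bigr),$$ where the implied constant depends only on $G$, and $$A_G=\sum_{n_1,\ldots,n_k=1}^{\infty}\frac{(\mu*\delta_G)(n_1,\ldots,n_k)}{n_1\cdots n_k} =\prod_p\left(\left(1-\frac1p\right)^k\sum_{\nu_1,\ldots,\nu_k=0}^{\infty}\frac{\delta_G(p^{\nu_1},\ldots,p^{\nu_k})}{p^{\nu_1+\cdots+\nu_k}}\right),$$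 where the products are over the primes $p$ and all the series and products converge unconditionally (independently of the order of the terms or factors). Moreover, for every vertex cover $J$ of $G$ (that is, every set $J\subseteq V$ containing at least one endpoint of each edge; in particular a minimum one), $$A_G=\prod_p\left(\ \sum_{\substack{L\subseteq J\\ L\text{ independent}}}\frac1{p^{|L|}}\left(1-\frac1p\right)^{|J\setminus L|+|N(L)\setminus J|}\right),$$ where a set $L$ of vertices is independent if no two of its vertices are adjacent in $G$, and $N(L)$ is the set of all vertices adjacent to at least one vertex of $L$. -/

import Mathlib

namespace CoprimalityGraph

/-- The characteristic function of the `k`-tuples whose components are coprime along every edge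
of `G`. Functions of `k` variables are defined on `Fin k → ℕ` and used at positive integers. -/
noncomputable def delta {k : ℕ} (G : SimpleGraph (Fin k)) [DecidableRel G.Adj] (n : Fin k → ℕ) : ℝ :=
  if ∀ i j, G.Adj i j → Nat.gcd (n i) (n j) = 1 then 1 else 0

/-- The Dirichlet convolution of functions of `k` variables:
`(f * g)(n₁,…,n_k) = ∑_{d₁ ∣ n₁, …, d_k ∣ n_k} f(d₁,…,d_k) g(n₁/d₁,…,n_k/d_k)`. -/
noncomputable def conv {k : ℕ} (f g : (Fin k → ℕ) → ℝ) (n : Fin k → ℕ) : ℝ :=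
  ∑ d ∈ Fintype.piFinset (fun i => (n i).divisors), f d * g (fun i => n i / d i)

/-- The Möbius function of `k` variables, `μ(n₁,…,n_k) = μ(n₁)⋯μ(n_k)`. -/
noncomputable def mobius {k : ℕ} (n : Fin k → ℕ) : ℝ :=
  ∏ i, (ArithmeticFunction.moebius (n i) : ℝ)

/-- The neighbourhood `N(L) = ⋃_{j ∈ L} N(j)` of a set of vertices. -/
def nbhd {k : ℕ} (G : SimpleGraph (Fin k)) [DecidableRel G.Adj] (L : Finset (Fin k)) :
    Finset (Fin k) :=
  L.biUnion (fun j => G.neighborFinset j)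

/-- The independent subsets `L` of a set `J` of vertices. -/
def indepSubsets {k : ℕ} (G : SimpleGraph (Fin k)) [DecidableRel G.Adj] (J : Finset (Fin k)) :
    Finset (Finset (Fin k)) :=
  J.powerset.filter (fun L => G.IsIndepSet (L : Set (Fin k)))

/-- The `k`-tuples of positive integers with all components at most `x`. -/
noncomputable def box (k : ℕ) (x : ℝ) : Finset (Fin k → ℕ) :=
  Fintype.piFinset (fun _ => Finset.Icc 1 ⌊x⌋₊)

end CoprimalityGraph

open Finset

namespace CoprimalityGraph

/-! Coprimality along edges is tested prime by prime: `delta G n` is the product over `p` of `ind G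
(dvdSet n p)`. Let `coef G` be the Möbius transform of `ind G` on the lattice of vertex sets.
Expanding the product shows that `μ * δ_G` is `mobDelta G`, supported on tuples with squarefree
components, where it is the product of `coef G (dvdSet n p)` (`conv_mobius_delta`). The transform is
1 at `∅`, 0 at singletons, -1 at edges and 0 at other pairs.

The analytic core is `exists_sum_abs_mobDelta_le`. A squarefree tuple is determined by the sets of
primes of each type `S = dvdSet n p`, so the sum of `|mobDelta| / ∏_{i ≠ j} n_i` over tuples with
`n_j ≤ x` is at most a product over `S` of sums with weight `|coef G S| / p ^ |S \ {j}|`. Each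
nonempty `S` with nonzero coefficient has exponent at least 2, hence a bounded factor, except the
edges at `j`; each of these costs one harmonic sum, so at most `d_G` logarithms arise. Cutting `n_j`
dyadically gives the tail bound `exists_tail_le` and absolute convergence. The asymptotics follow by
writing the count as `∑ mobDelta(d) ∏ ⌊x / d_i⌋` and changing one floor at a time.

Absolute convergence also gives the Euler product with factor `∑_S coef(S) p^{-|S|}`
(`hasProd_sum_coef`). By `sum_coef_mul_pow` this factor is the probability that a random set,
containing each vertex independently with probability `1/p`, is independent in `G`. Both product
formulas compute that probability: from the exponents `ν`, or by conditioning on the trace on `J`.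
-/

/-- The set of indices `i` with `p ∣ n i`. -/
def dvdSet {k : ℕ} (n : Fin k → ℕ) (p : ℕ) : Finset (Fin k) := univ.filter (fun i => p ∣ n i)

@[simp] lemma mem_dvdSet {k : ℕ} {n : Fin k → ℕ} {p : ℕ} {i : Fin k} :
    i ∈ dvdSet n p ↔ p ∣ n i := by simp [dvdSet]

/-- The indicator of independence of a set of vertices. -/
def ind {k : ℕ} (G : SimpleGraph (Fin k)) [DecidableRel G.Adj] (S : Finset (Fin k)) : ℝ :=
  if G.IsIndepSet (S : Set (Fin k)) then 1 else 0

/-! ### Möbius inversion on the lattice of vertex sets. -/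

/-- The Möbius transform of `ind` on the Boolean lattice. -/
def coef {k : ℕ} (G : SimpleGraph (Fin k)) [DecidableRel G.Adj] (S : Finset (Fin k)) : ℝ :=
  ∑ T ∈ S.powerset, ind G T * (-1) ^ (S \ T).card

/-- Summation over chains `U ⊆ T ⊆ S`, reparametrized by `U` and `T \ U`. -/
lemma sum_powerset_powerset {α : Type*} [DecidableEq α] (S : Finset α)
    (F : Finset α → Finset α → ℝ) :
    ∑ T ∈ S.powerset, ∑ U ∈ T.powerset, F U (T \ U)
      = ∑ U ∈ S.powerset, ∑ W ∈ (S \ U).powerset, F U W := by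
  rw [Finset.sum_sigma', Finset.sum_sigma']
  refine Finset.sum_bij' (fun x _ => ⟨x.2, x.1 \ x.2⟩) (fun x _ => ⟨x.1 ∪ x.2, x.1⟩) ?_ ?_ ?_ ?_ ?_
  · rintro ⟨T, U⟩ h
    simp only [mem_sigma, mem_powerset] at h ⊢
    exact ⟨h.2.trans h.1, sdiff_subset_sdiff h.1 le_rfl⟩
  · rintro ⟨U, W⟩ h
    simp only [mem_sigma, mem_powerset] at h ⊢
    exact ⟨union_subset h.1 (h.2.trans sdiff_subset), subset_union_left⟩
  · rintro ⟨T, U⟩ h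
    simp only [mem_sigma, mem_powerset] at h
    simp [union_sdiff_of_subset h.2]
  · rintro ⟨U, W⟩ h
    simp only [mem_sigma, mem_powerset] at h
    have : (U ∪ W) \ U = W := by
      rw [union_sdiff_left]
      exact sdiff_eq_self_of_disjoint (disjoint_sdiff.mono_right h.2).symm
    simp [this]
  · rintro ⟨T, U⟩ h
    rfl

variable {k : ℕ} (G : SimpleGraph (Fin k)) [DecidableRel G.Adj]

/-- After interchanging the sums, the alternating sum over subsets of `S \ U` vanishes unless `U =
S`. -/
lemma sum_coef_powerset (S : Finset (Fin k)) : ∑ T ∈ S.powerset, coef G T = ind G S := by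
  unfold coef
  rw [sum_powerset_powerset S (fun U W => ind G U * (-1) ^ W.card)]
  simp_rw [← Finset.mul_sum]
  rw [Finset.sum_eq_single S]
  · simp
  · intro U hU hne
    have h := Finset.sum_powerset_neg_one_pow_card (x := S \ U)
    have h' : (∑ m ∈ (S \ U).powerset, (-1 : ℝ) ^ m.card)
        = ((∑ m ∈ (S \ U).powerset, (-1 : ℤ) ^ m.card : ℤ) : ℝ) := by push_cast; rfl
    rw [h', h, if_neg]
    · simp
    · rw [sdiff_eq_empty_iff_subset]
      exact fun h => hne (subset_antisymm (mem_powerset.1 hU) h)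
  · simp

@[simp] lemma ind_empty : ind G ∅ = 1 := by simp [ind, Set.pairwise_empty, SimpleGraph.IsIndepSet]

@[simp] lemma ind_singleton (i : Fin k) : ind G {i} = 1 := by simp [ind, SimpleGraph.IsIndepSet]

@[simp] lemma coef_empty : coef G ∅ = 1 := by simp [coef]

lemma powerset_singleton_eq (i : Fin k) : ({i} : Finset (Fin k)).powerset = {∅, {i}} := by
  ext; simp [Finset.subset_singleton_iff]

lemma coef_singleton (i : Fin k) : coef G {i} = 0 := by
  have h := sum_coef_powerset G {i}
  rw [powerset_singleton_eq, Finset.sum_pair (by simp)] at h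
  simpa using h

/-- Inversion over the four subsets of the pair. That the absolute value never exceeds 1 is what
limits each edge to a single logarithm later. -/
lemma coef_pair {i j : Fin k} (h : i ≠ j) : coef G {i, j} = if G.Adj i j then -1 else 0 := by
  have h1 := sum_coef_powerset G {i, j}
  have h2 : ({i, j} : Finset (Fin k)).powerset = {∅, {i}, {j}, {i, j}} := by
    rw [Finset.powerset_insert, powerset_singleton_eq]
    ext s
    simp only [mem_union, mem_insert, mem_singleton, image_insert, image_singleton]
    simp only [insert_empty_eq]
    tauto
  have e1 : ({i} : Finset (Fin k)) ≠ {j} := by simpa using h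
  have e2 : ({i} : Finset (Fin k)) ≠ {i, j} := by
    intro e
    have : j ∈ ({i} : Finset (Fin k)) := by rw [e]; simp
    exact h (by simpa [eq_comm] using this)
  have e3 : ({j} : Finset (Fin k)) ≠ {i, j} := by
    intro e
    have : i ∈ ({j} : Finset (Fin k)) := by rw [e]; simp
    exact h (by simpa using this)
  rw [h2, Finset.sum_insert, Finset.sum_insert, Finset.sum_insert, Finset.sum_singleton,
    coef_singleton, coef_singleton, coef_empty] at h1
  · have h3 : ind G {i, j} = if G.Adj i j then 0 else 1 := by
      unfold ind
      have : G.IsIndepSet (({i, j} : Finset (Fin k)) : Set (Fin k)) ↔ ¬ G.Adj i j := by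
        rw [SimpleGraph.isIndepSet_iff, coe_pair, Set.pairwise_pair]
        simp [h, G.adj_comm j i]
      by_cases hA : G.Adj i j
      · rw [if_neg (fun h => this.1 h hA), if_pos hA]
      · rw [if_pos (this.2 hA), if_neg hA]
    rw [h3] at h1
    split_ifs at h1 ⊢ <;> linarith
  · simpa using e3
  · simp [e1, e2]
  · simp only [mem_insert, mem_singleton, not_or]
    exact ⟨(singleton_ne_empty _).symm, (singleton_ne_empty _).symm, (insert_ne_empty _ _).symm⟩

lemma abs_coef_pair_le {i j : Fin k} (h : i ≠ j) : |coef G {i, j}| ≤ 1 := by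
  rw [coef_pair G h]; split_ifs <;> simp

/-! ### Polynomial identities for the local factor. -/

/-- The local factor in terms of the Möbius transform. -/
lemma sum_coef_mul_pow (q : ℝ) :
    ∑ S : Finset (Fin k), coef G S * q ^ S.card
      = ∑ I : Finset (Fin k), ind G I * (q ^ I.card * (1 - q) ^ (k - I.card)) := by
  have h1 : ∀ S : Finset (Fin k), coef G S * q ^ S.card =
      ∑ U ∈ S.powerset, ind G U * (q ^ U.card * (-q) ^ (S \ U).card) := by
    intro S
    rw [coef, Finset.sum_mul]
    refine Finset.sum_congr rfl fun U hU => ?_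
    have : S.card = U.card + (S \ U).card := by
      rw [add_comm, card_sdiff_add_card_eq_card (mem_powerset.1 hU)]
    rw [this, pow_add, neg_pow q]
    ring
  simp_rw [h1]
  rw [← Finset.powerset_univ, sum_powerset_powerset univ
    (fun U W => ind G U * (q ^ U.card * (-q) ^ W.card))]
  refine Finset.sum_congr rfl fun U _ => ?_
  rw [← Finset.mul_sum, ← Finset.mul_sum]
  have := Finset.sum_pow_mul_eq_add_pow (-q) 1 (univ \ U)
  simp only [one_pow, mul_one] at this
  rw [this, ← compl_eq_univ_sdiff, card_compl, Fintype.card_fin]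
  ring

/-- Summation over independent sets, organised by the trace on a vertex cover. -/
lemma sum_ind_eq_sum_indepSubsets (q : ℝ) (J : Finset (Fin k))
    (hJ : G.IsVertexCover (J : Set (Fin k))) :
    ∑ I : Finset (Fin k), ind G I * (q ^ I.card * (1 - q) ^ (k - I.card))
      = ∑ L ∈ indepSubsets G J,
          q ^ L.card * (1 - q) ^ ((J \ L).card + (nbhd G L \ J).card) := by
  have hinner : ∀ L ∈ indepSubsets G J,
      q ^ L.card * (1 - q) ^ ((J \ L).card + (nbhd G L \ J).card)
        = ∑ R ∈ (Jᶜ \ nbhd G L).powerset,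
          q ^ (L ∪ R).card * (1 - q) ^ (k - (L ∪ R).card) := by
    intro L hL
    have hLJ : L ⊆ J := by
      simp only [indepSubsets, mem_filter, mem_powerset] at hL; exact hL.1
    -- The vertices outside `J` and not adjacent to `L` are unconstrained; their total weight is a
    -- power of `q + (1 - q) = 1`, inserted here as a factor.
    have h1 := Finset.sum_pow_mul_eq_add_pow q (1 - q) (Jᶜ \ nbhd G L)
    rw [add_sub_cancel, one_pow] at h1
    refine ((mul_one _).symm.trans (congrArg _ h1.symm)).trans ?_
    rw [Finset.mul_sum]
    refine Finset.sum_congr rfl fun R hR => ?_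
    rw [mem_powerset] at hR
    have hd : Disjoint L R := by
      refine disjoint_of_subset_left hLJ (disjoint_of_subset_right hR ?_)
      exact disjoint_of_subset_right sdiff_subset disjoint_compl_right
    have e1 : (J \ L).card + L.card = J.card := card_sdiff_add_card_eq_card hLJ
    have e2 : (Jᶜ \ nbhd G L).card + (nbhd G L \ J).card = Jᶜ.card := by
      have : nbhd G L \ J = Jᶜ ∩ nbhd G L := by ext; simp [and_comm]
      rw [this, card_sdiff_add_card_inter]
    have e3 : Jᶜ.card + J.card = k := by
      rw [card_compl, Fintype.card_fin]
      exact Nat.sub_add_cancel (by simpa using card_le_univ J)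
    have e4 := card_le_card hR
    rw [card_union_of_disjoint hd]
    have : k - (L.card + R.card) = (J \ L).card + (nbhd G L \ J).card
        + ((Jᶜ \ nbhd G L).card - R.card) := by omega
    rw [this, pow_add, pow_add]
    ring
  rw [Finset.sum_congr rfl hinner, Finset.sum_sigma']
  have h0 : ∑ I : Finset (Fin k), ind G I * (q ^ I.card * (1 - q) ^ (k - I.card))
      = ∑ I ∈ univ.filter (fun I : Finset (Fin k) => G.IsIndepSet (I : Set (Fin k))),
        q ^ I.card * (1 - q) ^ (k - I.card) := by
    rw [Finset.sum_filter]
    refine Finset.sum_congr rfl fun I _ => ?_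
    unfold ind; split_ifs <;> simp
  rw [h0]
  refine Finset.sum_bij' (fun I _ => ⟨I ∩ J, I \ J⟩) (fun x _ => x.1 ∪ x.2) ?_ ?_ ?_ ?_ ?_
  · intro I hI
    simp only [mem_filter, mem_univ, true_and] at hI
    simp only [mem_sigma, mem_powerset, indepSubsets, mem_filter]
    refine ⟨⟨inter_subset_right, hI.mono (by simp)⟩, ?_⟩
    intro v hv
    simp only [mem_sdiff, mem_compl, nbhd, mem_biUnion, mem_inter,
      SimpleGraph.mem_neighborFinset, not_exists, not_and] at hv ⊢
    refine ⟨hv.2, fun u hu hadj => ?_⟩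
    exact hI (mem_coe.2 hu.1) (mem_coe.2 hv.1) hadj.ne hadj
  · rintro ⟨L, R⟩ h
    simp only [mem_sigma, mem_powerset, indepSubsets, mem_filter] at h
    obtain ⟨⟨hLJ, hL⟩, hR⟩ := h
    simp only [mem_filter, mem_univ, true_and]
    have hRJ : ∀ v ∈ R, v ∉ J ∧ ∀ u ∈ L, ¬ G.Adj u v := by
      intro v hv
      have := hR hv
      simpa [nbhd] using this
    intro u hu v hv hne hadj
    simp only [coe_union, Set.mem_union, mem_coe] at hu hv
    rcases hu with hu | hu <;> rcases hv with hv | hv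
    · exact hL (mem_coe.2 hu) (mem_coe.2 hv) hne hadj
    · exact (hRJ v hv).2 u hu hadj
    · exact (hRJ u hu).2 v hv hadj.symm
    -- Two vertices outside a vertex cover are never adjacent.
    · rcases hJ hadj with h | h
      · exact (hRJ u hu).1 h
      · exact (hRJ v hv).1 h
  · intro I _
    ext v; simp; tauto
  · rintro ⟨L, R⟩ h
    simp only [mem_sigma, mem_powerset, indepSubsets, mem_filter] at h
    obtain ⟨⟨hLJ, -⟩, hR⟩ := h
    have hRJ : ∀ v ∈ R, v ∉ J := fun v hv => by simpa using (mem_sdiff.1 (hR hv)).1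
    have a1 : (L ∪ R) ∩ J = L := by
      ext v; simp only [mem_inter, mem_union]
      constructor
      · rintro ⟨h | h, h'⟩
        · exact h
        · exact absurd h' (hRJ v h)
      · exact fun h => ⟨Or.inl h, hLJ h⟩
    have a2 : (L ∪ R) \ J = R := by
      ext v; simp only [mem_sdiff, mem_union]
      constructor
      · rintro ⟨h | h, h'⟩
        · exact absurd (hLJ h) h'
        · exact h
      · exact fun h => ⟨Or.inr h, hRJ v h⟩
    simp [a1, a2]
  · intro I _
    have : I ∩ J ∪ I \ J = I := by ext v; simp; tauto
    simp only [this]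

/-! ### Squarefree tuples and the convolution `μ * δ_G`. -/

lemma squarefree_prod_primes (Q : Finset ℕ) (hQ : ∀ p ∈ Q, p.Prime) : Squarefree (∏ p ∈ Q, p) := by
  refine Finset.squarefree_prod_of_pairwise_isCoprime ?_ (fun p hp => (hQ p hp).squarefree)
  intro p hp q hq hne
  exact Nat.coprime_iff_isRelPrime.1 ((Nat.coprime_primes (hQ p hp) (hQ q hq)).2 hne)

lemma primeFactors_prod_primes (Q : Finset ℕ) (hQ : ∀ p ∈ Q, p.Prime) :
    (∏ p ∈ Q, p).primeFactors = Q := Nat.primeFactors_prod hQ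

lemma prime_dvd_prod_primes {Q : Finset ℕ} (hQ : ∀ p ∈ Q, p.Prime) {p : ℕ} (hp : p.Prime) :
    p ∣ ∏ q ∈ Q, q ↔ p ∈ Q := by
  rw [← primeFactors_prod_primes Q hQ, Nat.mem_primeFactors, primeFactors_prod_primes Q hQ]
  simp only [hp, true_and, iff_self_and]
  intro _
  exact Finset.prod_ne_zero_iff.2 fun q hq => (hQ q hq).ne_zero

open Classical in
/-- Expansion of a product over primes as a sum over tuples of squarefree divisors. -/
lemma prod_sum_powerset_dvdSet (n : Fin k → ℕ) (hn : ∀ i, n i ≠ 0) (P : Finset ℕ)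
    (hP : ∀ p ∈ P, p.Prime) (hnP : ∀ i, (n i).primeFactors ⊆ P)
    (a : ℕ → Finset (Fin k) → ℝ) :
    ∏ p ∈ P, ∑ T ∈ (dvdSet n p).powerset, a p T
      = ∑ d ∈ (Fintype.piFinset (fun i => (n i).divisors)).filter (fun d => ∀ i, Squarefree (d i)),
          ∏ p ∈ P, a p (dvdSet d p) := by
  rw [Finset.prod_sum]
  have hQ : ∀ (φ : (p : ℕ) → p ∈ P → Finset (Fin k)) (i : Fin k),
      ∀ p ∈ P.filter (fun p => ∃ h : p ∈ P, i ∈ φ p h), p.Prime :=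
    fun φ i p hp => hP p (mem_filter.1 hp).1
  have hdvd : ∀ (φ : (p : ℕ) → p ∈ P → Finset (Fin k)) (p : ℕ) (h : p ∈ P),
      dvdSet (fun i => ∏ p ∈ P.filter (fun p => ∃ h : p ∈ P, i ∈ φ p h), p) p = φ p h := by
    intro φ p h
    ext i
    rw [mem_dvdSet, prime_dvd_prod_primes (hQ φ i) (hP p h)]
    simp [h]
  -- A choice of vertex set `φ p` for each prime corresponds to the tuple whose `i`-th component is
  -- the product of the `p` with `i ∈ φ p`.
  refine Finset.sum_bij'
    (fun φ _ => fun i => ∏ p ∈ P.filter (fun p => ∃ h : p ∈ P, i ∈ φ p h), p)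
    (fun d _ => fun p _ => dvdSet d p) ?_ ?_ ?_ ?_ ?_
  · intro φ hφ
    simp only [mem_pi, mem_powerset] at hφ
    simp only [mem_filter, Fintype.mem_piFinset, Nat.mem_divisors]
    refine ⟨fun i => ⟨?_, hn i⟩, fun i => squarefree_prod_primes _ (hQ φ i)⟩
    refine Finset.prod_primes_dvd _ (fun p hp => (hQ φ i p hp).prime) fun p hp => ?_
    obtain ⟨h, hi⟩ := (mem_filter.1 hp).2
    exact mem_dvdSet.1 (hφ p h hi)
  · intro d hd
    simp only [mem_filter, Fintype.mem_piFinset, Nat.mem_divisors] at hd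
    simp only [mem_pi, mem_powerset]
    intro p _ i hi
    rw [mem_dvdSet] at hi ⊢
    exact hi.trans (hd.1 i).1
  · intro φ _
    funext p h
    exact hdvd φ p h
  · intro d hd
    simp only [mem_filter, Fintype.mem_piFinset, Nat.mem_divisors] at hd
    funext i
    rw [← Nat.prod_primeFactors_of_squarefree (hd.2 i)]
    refine Finset.prod_congr ?_ fun _ _ => rfl
    ext p
    simp only [mem_filter, mem_dvdSet, exists_prop, Nat.mem_primeFactors]
    constructor
    · rintro ⟨h, -, h'⟩
      exact ⟨hP p h, h', (hd.2 i).ne_zero⟩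
    · rintro ⟨h, h', -⟩
      have : p ∈ P := hnP i (Nat.mem_primeFactors.2 ⟨h, h'.trans (hd.1 i).1, hn i⟩)
      exact ⟨this, this, h'⟩
  · intro φ _
    rw [← Finset.prod_attach P]
    refine Finset.prod_congr rfl fun p _ => ?_
    rw [hdvd φ p.1 p.2]

open Classical in
/-- The convolution of `mobius` and `delta G`, in closed form. -/
noncomputable def mobDelta (n : Fin k → ℕ) : ℝ :=
  if ∀ i, Squarefree (n i) then ∏ p ∈ (∏ i, n i).primeFactors, coef G (dvdSet n p) else 0

lemma dvdSet_eq_empty {n : Fin k → ℕ} (hn : ∀ i, n i ≠ 0) {p : ℕ} (hp : p.Prime)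
    (h : p ∉ (∏ i, n i).primeFactors) : dvdSet n p = ∅ := by
  ext i
  simp only [mem_dvdSet, notMem_empty, iff_false]
  intro hd
  exact h (Nat.mem_primeFactors.2 ⟨hp, hd.trans (dvd_prod_of_mem n (mem_univ i)),
    prod_ne_zero_iff.2 fun i _ => hn i⟩)

lemma primeFactors_subset_prod {n : Fin k → ℕ} (hn : ∀ i, n i ≠ 0) (i : Fin k) :
    (n i).primeFactors ⊆ (∏ i, n i).primeFactors :=
  Nat.primeFactors_mono (dvd_prod_of_mem n (mem_univ i)) (prod_ne_zero_iff.2 fun i _ => hn i)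

/-- Extra primes are harmless because `coef G ∅ = 1`; this lets all divisors of one tuple share the
same set of primes. -/
lemma mobDelta_eq {n : Fin k → ℕ} (hn : ∀ i, Squarefree (n i)) {P : Finset ℕ}
    (hP : ∀ p ∈ P, p.Prime) (hnP : ∀ i, (n i).primeFactors ⊆ P) :
    mobDelta G n = ∏ p ∈ P, coef G (dvdSet n p) := by
  rw [mobDelta, if_pos hn]
  have hn0 : ∀ i, n i ≠ 0 := fun i => (hn i).ne_zero
  refine Finset.prod_subset ?_ fun p hp hp' => ?_
  · intro p hp
    rw [Nat.mem_primeFactors] at hp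
    obtain ⟨i, -, hi⟩ := (hp.1.prime.dvd_finsetProd_iff _).1 hp.2.1
    exact hnP i (Nat.mem_primeFactors.2 ⟨hp.1, hi, hn0 i⟩)
  · rw [dvdSet_eq_empty hn0 (hP p hp) hp', coef_empty]

lemma mobDelta_of_not_squarefree {n : Fin k → ℕ} (h : ¬ ∀ i, Squarefree (n i)) :
    mobDelta G n = 0 := by rw [mobDelta, if_neg h]

lemma delta_eq_prod_ind {n : Fin k → ℕ} (hn : ∀ i, n i ≠ 0) :
    delta G n = ∏ p ∈ (∏ i, n i).primeFactors, ind G (dvdSet n p) := by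
  unfold delta
  split_ifs with h
  · symm
    refine Finset.prod_eq_one fun p hp => ?_
    rw [ind, if_pos]
    intro i hi j hj _ hadj
    simp only [mem_coe, mem_dvdSet] at hi hj
    have := Nat.dvd_gcd hi hj
    rw [h i j hadj] at this
    exact (Nat.prime_of_mem_primeFactors hp).one_lt.ne' (Nat.dvd_one.1 this)
  · push Not at h
    obtain ⟨i, j, hadj, hg⟩ := h
    obtain ⟨p, hp, hpd⟩ := Nat.exists_prime_and_dvd hg
    have hi := hpd.trans (Nat.gcd_dvd_left _ _)
    have hj := hpd.trans (Nat.gcd_dvd_right _ _)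
    symm
    refine Finset.prod_eq_zero (i := p) ?_ ?_
    · exact primeFactors_subset_prod hn i (Nat.mem_primeFactors.2 ⟨hp, hi, hn i⟩)
    · rw [ind, if_neg]
      intro hI
      exact hI (by simpa using hi) (by simpa using hj) hadj.ne hadj

/-- Möbius inversion, summatory form: `delta G` is the divisor sum of `mobDelta G`. -/
lemma delta_eq_sum_mobDelta {n : Fin k → ℕ} (hn : ∀ i, n i ≠ 0) :
    delta G n = ∑ d ∈ Fintype.piFinset (fun i => (n i).divisors), mobDelta G d := by
  classical
  rw [delta_eq_prod_ind G hn]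
  simp_rw [← sum_coef_powerset]
  have hP : ∀ p ∈ (∏ i, n i).primeFactors, p.Prime := fun p => Nat.prime_of_mem_primeFactors
  rw [prod_sum_powerset_dvdSet n hn _ hP (primeFactors_subset_prod hn)
    (fun _ T => coef G T), Finset.sum_filter]
  refine Finset.sum_congr rfl fun d hd => ?_
  simp only [Fintype.mem_piFinset, Nat.mem_divisors] at hd
  split_ifs with h
  · rw [mobDelta_eq G h hP]
    exact fun i => (Nat.primeFactors_mono (hd i).1 (hn i)).trans (primeFactors_subset_prod hn i)
  · rw [mobDelta_of_not_squarefree G h]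

lemma sum_divisors_mobius {n : Fin k → ℕ} :
    ∑ d ∈ Fintype.piFinset (fun i => (n i).divisors), mobius d
      = if ∀ i, n i = 1 then 1 else 0 := by
  unfold mobius
  rw [← Finset.prod_univ_sum (fun i => (n i).divisors)
    (fun _ m => ((ArithmeticFunction.moebius m : ℤ) : ℝ))]
  have h : ∀ m : ℕ, ∑ d ∈ m.divisors, ((ArithmeticFunction.moebius d : ℤ) : ℝ)
      = if m = 1 then 1 else 0 := by
    intro m
    have h := congrArg (fun f => f m) ArithmeticFunction.moebius_mul_coe_zeta
    simp only [ArithmeticFunction.coe_mul_zeta_apply, ArithmeticFunction.one_apply] at h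
    exact_mod_cast h
  simp_rw [h]
  split_ifs with h1
  · simp [h1]
  · push Not at h1
    obtain ⟨i, hi⟩ := h1
    exact Finset.prod_eq_zero (mem_univ i) (by simp [hi])

/-- Insert the divisor sum for `delta G` and interchange: the inner sum of `mobius` over divisors of
`n / c` keeps only `c = n`. -/
lemma conv_mobius_delta {n : Fin k → ℕ} (hn : ∀ i, n i ≠ 0) :
    conv mobius (delta G) n = mobDelta G n := by
  unfold conv
  have h1 : ∀ d ∈ Fintype.piFinset (fun i => (n i).divisors),
      mobius d * delta G (fun i => n i / d i)
        = ∑ c ∈ Fintype.piFinset (fun i => (n i / d i).divisors), mobius d * mobDelta G c := by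
    intro d hd
    simp only [Fintype.mem_piFinset, Nat.mem_divisors] at hd
    rw [delta_eq_sum_mobDelta, Finset.mul_sum]
    exact fun i => (Nat.div_pos (Nat.le_of_dvd (Nat.pos_of_ne_zero (hn i)) (hd i).1)
      (Nat.pos_of_dvd_of_pos (hd i).1 (Nat.pos_of_ne_zero (hn i)))).ne'
  have hmem : ∀ {n d c : ℕ}, n ≠ 0 →
      (d ∈ n.divisors ∧ c ∈ (n / d).divisors ↔ d ∈ (n / c).divisors ∧ c ∈ n.divisors) := by
    have key : ∀ {n d c : ℕ}, n ≠ 0 →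
        d ∈ n.divisors ∧ c ∈ (n / d).divisors → d ∈ (n / c).divisors ∧ c ∈ n.divisors := by
      intro n d c hn h
      simp only [Nat.mem_divisors] at h ⊢
      have hdc : d * c ∣ n := Nat.mul_dvd_of_dvd_div h.1.1 h.2.1
      have hc : c ∣ n := (dvd_mul_left c d).trans hdc
      refine ⟨⟨(Nat.dvd_div_iff_mul_dvd hc).2 (by rwa [mul_comm]), ?_⟩, hc, hn⟩
      exact (Nat.div_pos (Nat.le_of_dvd (Nat.pos_of_ne_zero hn) hc)
        (Nat.pos_of_dvd_of_pos hc (Nat.pos_of_ne_zero hn))).ne'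
    intro n d c hn
    exact ⟨key hn, fun h => (key hn h.symm).symm⟩
  rw [Finset.sum_congr rfl h1, Finset.sum_comm'
    (s' := fun c => Fintype.piFinset (fun i => (n i / c i).divisors))
    (t' := Fintype.piFinset (fun i => (n i).divisors))]
  · simp_rw [← Finset.sum_mul, sum_divisors_mobius]
    rw [Finset.sum_eq_single n]
    · rw [if_pos (fun i => Nat.div_self (Nat.pos_of_ne_zero (hn i))), one_mul]
    · intro c hc hne
      rw [if_neg, zero_mul]
      intro h
      refine hne (funext fun i => ?_)
      simp only [Fintype.mem_piFinset, Nat.mem_divisors] at hc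
      exact (Nat.eq_of_dvd_of_div_eq_one (hc i).1 (h i))
    · intro h
      exact absurd (Fintype.mem_piFinset.2 fun i => Nat.mem_divisors_self _ (hn i)) h
  · intro d c
    simp only [Fintype.mem_piFinset, ← forall_and]
    exact forall_congr' fun i => hmem (hn i)

lemma prod_pow_card_dvd {n : Fin k → ℕ} (hn : ∀ i, Squarefree (n i)) {P : Finset ℕ}
    (hP : ∀ p ∈ P, p.Prime) (hnP : ∀ i, (n i).primeFactors ⊆ P) (K : Finset (Fin k)) :
    ∏ p ∈ P, (p : ℝ) ^ (K.filter (fun i => p ∣ n i)).card = ∏ i ∈ K, (n i : ℝ) := by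
  have h1 : ∀ p ∈ P, (p : ℝ) ^ (K.filter (fun i => p ∣ n i)).card
      = ∏ i ∈ K, if p ∣ n i then (p : ℝ) else 1 := by
    intro p _
    rw [← Finset.prod_filter, Finset.prod_const]
  rw [Finset.prod_congr rfl h1, Finset.prod_comm]
  refine Finset.prod_congr rfl fun i _ => ?_
  rw [← Finset.prod_filter]
  conv_rhs => rw [← Nat.prod_primeFactors_of_squarefree (hn i)]
  rw [Nat.cast_prod]
  refine Finset.prod_congr ?_ fun _ _ => rfl
  ext p
  simp only [mem_filter, Nat.mem_primeFactors]
  constructor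
  · exact fun h => ⟨hP p h.1, h.2, (hn i).ne_zero⟩
  · exact fun h => ⟨hnP i (Nat.mem_primeFactors.2 h), h.2.1⟩

/-! ### Sorting primes by type and bounding weighted sums. -/

/-- The primes `p` dividing exactly the components of `n` indexed by `S`. -/
def typePrimes (n : Fin k → ℕ) (S : Finset (Fin k)) : Finset ℕ :=
  (∏ i, n i).primeFactors.filter (fun p => dvdSet n p = S)

lemma prime_of_mem_typePrimes {n : Fin k → ℕ} {S : Finset (Fin k)} {p : ℕ}
    (h : p ∈ typePrimes n S) : p.Prime := Nat.prime_of_mem_primeFactors (mem_filter.1 h).1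

lemma typePrimes_empty {n : Fin k → ℕ} : typePrimes n ∅ = ∅ := by
  ext p
  simp only [typePrimes, mem_filter, notMem_empty, iff_false, not_and]
  intro hp he
  rw [Nat.mem_primeFactors] at hp
  obtain ⟨i, -, hi⟩ := (hp.1.prime.dvd_finsetProd_iff _).1 hp.2.1
  have : i ∈ dvdSet n p := mem_dvdSet.2 hi
  rw [he] at this
  exact notMem_empty _ this

lemma prod_typePrimes_le {n : Fin k → ℕ} (hn : ∀ i, n i ≠ 0) {S : Finset (Fin k)} {j : Fin k}
    (hj : j ∈ S) : ∏ p ∈ typePrimes n S, p ≤ n j := by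
  refine Nat.le_of_dvd (Nat.pos_of_ne_zero (hn j)) ?_
  refine Finset.prod_primes_dvd _ (fun p hp => (prime_of_mem_typePrimes hp).prime) fun p hp => ?_
  have := (mem_filter.1 hp).2
  rw [← mem_dvdSet, this]
  exact hj

/-- The prime factors of `n i` are the primes of all types containing `i`, and they determine a
squarefree `n i`. -/
lemma typePrimes_injOn {n m : Fin k → ℕ} (hn : ∀ i, Squarefree (n i))
    (hm : ∀ i, Squarefree (m i)) (h : typePrimes n = typePrimes m) : n = m := by
  have key : ∀ {n : Fin k → ℕ}, (∀ i, Squarefree (n i)) → ∀ i p,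
      p ∈ (n i).primeFactors ↔ ∃ S, i ∈ S ∧ p ∈ typePrimes n S := by
    intro n hn i p
    constructor
    · intro hp
      refine ⟨dvdSet n p, mem_dvdSet.2 (Nat.dvd_of_mem_primeFactors hp), mem_filter.2 ⟨?_, rfl⟩⟩
      exact primeFactors_subset_prod (fun i => (hn i).ne_zero) i hp
    · rintro ⟨S, hi, hp⟩
      refine Nat.mem_primeFactors.2 ⟨prime_of_mem_typePrimes hp, ?_, (hn i).ne_zero⟩
      rw [← mem_dvdSet, (mem_filter.1 hp).2]
      exact hi
  funext i
  rw [← Nat.prod_primeFactors_of_squarefree (hn i), ← Nat.prod_primeFactors_of_squarefree (hm i)]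
  refine Finset.prod_congr ?_ fun _ _ => rfl
  ext p
  rw [key hn, key hm, h]

/-- Sums of products over primes of weights depending on the type `dvdSet n p` are bounded by the
product over all types. -/
lemma sum_prod_weight_le (B : Finset (Fin k → ℕ)) (hB : ∀ n ∈ B, ∀ i, Squarefree (n i))
    (w : Finset (Fin k) → ℕ → ℝ) (hw : ∀ S p, 0 ≤ w S p) :
    ∑ n ∈ B, ∏ p ∈ (∏ i, n i).primeFactors, w (dvdSet n p) p
      ≤ ∏ S : Finset (Fin k), ∑ Q ∈ B.image (fun n => typePrimes n S), ∏ p ∈ Q, w S p := by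
  classical
  rw [Finset.prod_univ_sum]
  have h1 : ∀ n ∈ B, ∏ p ∈ (∏ i, n i).primeFactors, w (dvdSet n p) p
      = ∏ S, ∏ p ∈ typePrimes n S, w S p := by
    intro n _
    rw [← Finset.prod_fiberwise (∏ i, n i).primeFactors (dvdSet n)]
    refine Finset.prod_congr rfl fun S _ => Finset.prod_congr rfl fun p hp => ?_
    rw [(mem_filter.1 hp).2]
  rw [Finset.sum_congr rfl h1,
    ← Finset.sum_image (s := B) (g := fun n => typePrimes n)
      (f := fun φ => ∏ S, ∏ p ∈ φ S, w S p)
      (fun n hn m hm h => typePrimes_injOn (hB n hn) (hB m hm) h)]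
  -- Dropping the compatibility between the types makes the sum factor; nonnegativity of the weights
  -- makes this an upper bound.
  refine Finset.sum_le_sum_of_subset_of_nonneg ?_ ?_
  · intro φ hφ
    obtain ⟨n, hn, rfl⟩ := mem_image.1 hφ
    exact Fintype.mem_piFinset.2 fun S => mem_image_of_mem _ hn
  · exact fun φ _ _ => Finset.prod_nonneg fun S _ => Finset.prod_nonneg fun p _ => hw S p

lemma exists_sum_prod_le (c : ℝ) (hc : 0 ≤ c) (e : ℕ) (h : c = 0 ∨ 2 ≤ e) :
    ∃ C : ℝ, 1 ≤ C ∧ ∀ M : Finset (Finset ℕ), ∑ Q ∈ M, ∏ p ∈ Q, c / (p : ℝ) ^ e ≤ C := by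
  have hs : Summable fun p : ℕ => c / (p : ℝ) ^ e := by
    rcases h with rfl | h
    · simp
    · simpa [div_eq_mul_inv] using (Real.summable_nat_pow_inv.2 h).mul_left c
  have hs' := summable_finsetProd_of_summable_norm hs.norm
  refine ⟨max 1 (∑' Q : Finset ℕ, ∏ p ∈ Q, c / (p : ℝ) ^ e), le_max_left _ _, fun M => ?_⟩
  exact (hs'.sum_le_tsum M fun Q _ => Finset.prod_nonneg fun p _ => by positivity).trans
    (le_max_right _ _)

/-- Distinct sets of primes have distinct products, all at most `x`, so the sum is dominated by a
harmonic sum. The bound `c ≤ 1` keeps the logarithm to the first power. -/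
lemma sum_prod_inv_le (c : ℝ) (hc : 0 ≤ c) (hc1 : c ≤ 1) (x : ℝ) (hx : 1 ≤ x)
    (M : Finset (Finset ℕ)) (hM : ∀ Q ∈ M, (∀ p ∈ Q, p.Prime) ∧ ((∏ p ∈ Q, p : ℕ) : ℝ) ≤ x) :
    ∑ Q ∈ M, ∏ p ∈ Q, c / (p : ℝ) ^ 1 ≤ 1 + Real.log x := by
  calc ∑ Q ∈ M, ∏ p ∈ Q, c / (p : ℝ) ^ 1
      ≤ ∑ Q ∈ M, ((∏ p ∈ Q, p : ℕ) : ℝ)⁻¹ := by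
        refine Finset.sum_le_sum fun Q _ => ?_
        rw [Nat.cast_prod, ← Finset.prod_inv_distrib]
        refine Finset.prod_le_prod (fun p _ => by positivity) fun p _ => ?_
        rw [pow_one, div_eq_mul_inv]
        exact mul_le_of_le_one_left (by positivity) hc1
    _ = ∑ m ∈ M.image (fun Q => ∏ p ∈ Q, p), (m : ℝ)⁻¹ := by
        rw [Finset.sum_image]
        intro Q hQ R hR h
        rw [← primeFactors_prod_primes Q (hM Q hQ).1, ← primeFactors_prod_primes R (hM R hR).1]
        exact congrArg Nat.primeFactors h
    _ ≤ ∑ m ∈ Finset.Icc 1 ⌊x⌋₊, (m : ℝ)⁻¹ := by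
        refine Finset.sum_le_sum_of_subset_of_nonneg ?_ fun _ _ _ => by positivity
        intro m hm
        obtain ⟨Q, hQ, rfl⟩ := mem_image.1 hm
        refine mem_Icc.2 ⟨?_, Nat.le_floor (hM Q hQ).2⟩
        exact Finset.prod_pos fun p hp => ((hM Q hQ).1 p hp).pos
    _ = ((harmonic ⌊x⌋₊ : ℚ) : ℝ) := by rw [harmonic_eq_sum_Icc]; push_cast; rfl
    _ ≤ 1 + Real.log x := harmonic_floor_le_one_add_log x hx

/-- The tuples `S` contributing a logarithm: the edges through `j`. -/
def edgeSets (j : Fin k) : Finset (Finset (Fin k)) := (G.neighborFinset j).image (fun i => {i, j})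

lemma card_edgeSets_le (j : Fin k) : (edgeSets G j).card ≤ G.maxDegree :=
  card_image_le.trans (G.degree_le_maxDegree j)

/-- If `S.erase j` has at most one element, the nonempty `S` is a singleton or a pair through `j`;
the coefficient vanishes on singletons and on non-edges. -/
lemma two_le_card_erase_of_notMem_edgeSets {j : Fin k} {S : Finset (Fin k)} (hS : S ≠ ∅)
    (h : S ∉ edgeSets G j) : |coef G S| = 0 ∨ 2 ≤ (S.erase j).card := by
  by_contra! hcon
  obtain ⟨h0, h2⟩ := hcon
  rw [abs_ne_zero] at h0
  by_cases hj : j ∈ S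
  · rcases Nat.lt_or_ge 0 (S.erase j).card with h1 | h1
    · obtain ⟨i, hi⟩ := card_eq_one.1 (by omega : (S.erase j).card = 1)
      have hSe : S = {i, j} := by
        rw [← insert_erase hj, hi, pair_comm]
      have hij : i ≠ j := by
        have : i ∈ S.erase j := by rw [hi]; simp
        exact (mem_erase.1 this).1
      rw [hSe, coef_pair G hij] at h0
      refine h (mem_image.2 ⟨i, ?_, hSe.symm⟩)
      rw [SimpleGraph.mem_neighborFinset, G.adj_comm]
      by_contra hn
      simp [hn] at h0
    · have he := card_eq_zero.1 (by omega : (S.erase j).card = 0)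
      have : S = {j} := by rw [← insert_erase hj, he]; simp
      rw [this, coef_singleton] at h0
      exact h0 rfl
  · rw [erase_eq_of_notMem hj] at h2
    have := card_pos.2 (nonempty_iff_ne_empty.2 hS)
    obtain ⟨i, hi⟩ := card_eq_one.1 (by omega : S.card = 1)
    rw [hi, coef_singleton] at h0
    exact h0 rfl

/-- The basic estimate for `mobDelta`, with the `j`-th component at most `x` and no other
restriction on the tuples. -/
lemma exists_sum_abs_mobDelta_le (j : Fin k) : ∃ C : ℝ, 0 ≤ C ∧ ∀ x : ℝ, 1 ≤ x →
    ∀ B : Finset (Fin k → ℕ), (∀ n ∈ B, (n j : ℝ) ≤ x) →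
      ∑ n ∈ B, |mobDelta G n| / ∏ i ∈ univ.erase j, (n i : ℝ)
        ≤ C * (1 + Real.log x) ^ G.maxDegree := by
  classical
  have hC : ∀ S : Finset (Fin k), ∃ C : ℝ, 1 ≤ C ∧ (S ≠ ∅ → S ∉ edgeSets G j →
      ∀ M : Finset (Finset ℕ), ∑ Q ∈ M, ∏ p ∈ Q, |coef G S| / (p : ℝ) ^ (S.erase j).card ≤ C) := by
    intro S
    by_cases hS : S ≠ ∅ ∧ S ∉ edgeSets G j
    · obtain ⟨C, h1, h2⟩ := exists_sum_prod_le |coef G S| (abs_nonneg _) (S.erase j).card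
        (two_le_card_erase_of_notMem_edgeSets G hS.1 hS.2)
      exact ⟨C, h1, fun _ _ => h2⟩
    · exact ⟨1, le_rfl, fun h1 h2 => absurd ⟨h1, h2⟩ hS⟩
  choose C hC1 hC2 using hC
  refine ⟨∏ S, C S, Finset.prod_nonneg fun S _ => zero_le_one.trans (hC1 S), fun x hx B hB => ?_⟩
  have hlog : 1 ≤ 1 + Real.log x := by linarith [Real.log_nonneg hx]
  set B' := B.filter (fun n => ∀ i, Squarefree (n i)) with hB'
  have hsq : ∀ n ∈ B', ∀ i, Squarefree (n i) := fun n hn => (mem_filter.1 hn).2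
  have e1 : ∑ n ∈ B, |mobDelta G n| / ∏ i ∈ univ.erase j, (n i : ℝ)
      = ∑ n ∈ B', |mobDelta G n| / ∏ i ∈ univ.erase j, (n i : ℝ) := by
    rw [hB', Finset.sum_filter]
    refine Finset.sum_congr rfl fun n _ => ?_
    split_ifs with h
    · rfl
    · rw [mobDelta_of_not_squarefree G h]; simp
  have e2 : ∀ n ∈ B', |mobDelta G n| / ∏ i ∈ univ.erase j, (n i : ℝ)
      = ∏ p ∈ (∏ i, n i).primeFactors,
          |coef G (dvdSet n p)| / (p : ℝ) ^ ((dvdSet n p).erase j).card := by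
    intro n hn
    have hP : ∀ p ∈ (∏ i, n i).primeFactors, p.Prime := fun p => Nat.prime_of_mem_primeFactors
    have hnP := primeFactors_subset_prod fun i => (hsq n hn i).ne_zero
    rw [mobDelta_eq G (hsq n hn) hP hnP, Finset.abs_prod, Finset.prod_div_distrib,
      ← prod_pow_card_dvd (hsq n hn) hP hnP]
    congr 1
    refine Finset.prod_congr rfl fun p _ => ?_
    congr 2
    ext i
    simp
  rw [e1, Finset.sum_congr rfl e2]
  refine (sum_prod_weight_le B' hsq (fun S p => |coef G S| / (p : ℝ) ^ (S.erase j).card)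
    fun S p => by positivity).trans ?_
  calc _ ≤ ∏ S : Finset (Fin k), C S * (if S ∈ edgeSets G j then 1 + Real.log x else 1) := by
        refine Finset.prod_le_prod (fun S _ => Finset.sum_nonneg fun Q _ =>
          Finset.prod_nonneg fun p _ => by positivity) fun S _ => ?_
        -- The empty type has weight 1 at every prime, but no prime dividing `∏ n i` has it, so only
        -- `Q = ∅` occurs.
        by_cases hS : S = ∅
        · have hsub : B'.image (fun n => typePrimes n S) ⊆ {∅} := by
            intro Q hQ
            obtain ⟨n, -, rfl⟩ := mem_image.1 hQ
            rw [hS, typePrimes_empty]; simp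
          have h1 : (1 : ℝ) ≤ C S * (if S ∈ edgeSets G j then 1 + Real.log x else 1) := by
            refine one_le_mul_of_one_le_of_one_le (hC1 S) ?_
            split_ifs
            · exact hlog
            · exact le_rfl
          refine le_trans (Finset.sum_le_sum_of_subset_of_nonneg hsub fun Q _ _ =>
            Finset.prod_nonneg fun p _ => by positivity) ?_
          simpa using h1
        · split_ifs with hE
          · obtain ⟨i, hi, rfl⟩ := mem_image.1 hE
            rw [SimpleGraph.mem_neighborFinset] at hi
            have hij : i ≠ j := hi.ne'
            have hcard : (({i, j} : Finset (Fin k)).erase j).card = 1 := by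
              rw [card_erase_of_mem (by simp), card_pair hij]
            rw [hcard]
            refine (sum_prod_inv_le _ (abs_nonneg _) (abs_coef_pair_le G hij) x hx _ ?_).trans
              (le_mul_of_one_le_left (by linarith) (hC1 _))
            intro Q hQ
            obtain ⟨n, hn, rfl⟩ := mem_image.1 hQ
            refine ⟨fun p hp => prime_of_mem_typePrimes hp, ?_⟩
            have := prod_typePrimes_le (fun i => (hsq n hn i).ne_zero)
              (S := {i, j}) (j := j) (by simp)
            exact (Nat.cast_le.2 this).trans (hB n (mem_filter.1 hn).1)
          · rw [mul_one]
            exact hC2 S hS hE _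
    _ = (∏ S, C S) * (1 + Real.log x) ^ (edgeSets G j).card := by
        rw [Finset.prod_mul_distrib, ← Finset.prod_filter, Finset.prod_const]
        congr 3
        ext S; simp
    _ ≤ (∏ S, C S) * (1 + Real.log x) ^ G.maxDegree := by
        refine mul_le_mul_of_nonneg_left (pow_le_pow_right₀ hlog (card_edgeSets_le G j)) ?_
        exact Finset.prod_nonneg fun S _ => zero_le_one.trans (hC1 S)

/-! ### Tail estimate and absolute convergence. -/

open Filter Topology

lemma summable_shift_pow_mul_half (D : ℕ) :
    Summable fun r : ℕ => ((r : ℝ) + 4) ^ D * (1 / 2) ^ r := by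
  have h := summable_pow_mul_geometric_of_norm_lt_one (R := ℝ) D (r := 1 / 2) (by norm_num)
  have h2 := ((summable_nat_add_iff 4).2 h).mul_left 16
  refine h2.congr fun r => ?_
  push_cast
  rw [pow_add]
  ring

lemma abs_div_prod_eq (n : Fin k → ℕ) (j : Fin k) (a : ℝ) :
    a / ∏ i, (n i : ℝ) = a / (∏ i ∈ univ.erase j, (n i : ℝ)) / (n j : ℝ) := by
  rw [← Finset.prod_erase_mul univ (fun i => (n i : ℝ)) (mem_univ j), div_div]

/-- Dyadic estimate for the part of the series with large `j`-th component. -/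
lemma exists_tail_le (j : Fin k) : ∃ C : ℝ, 0 ≤ C ∧ ∀ x : ℝ, 2 ≤ x →
    ∀ B : Finset (Fin k → ℕ), (∀ n ∈ B, x < (n j : ℝ)) →
      ∑ n ∈ B, |mobDelta G n| / ∏ i, (n i : ℝ) ≤ C * (Real.log x ^ G.maxDegree / x) := by
  obtain ⟨C, hC0, hC⟩ := exists_sum_abs_mobDelta_le G j
  set D := G.maxDegree with hD
  refine ⟨C * ∑' r : ℕ, ((r : ℝ) + 4) ^ D * (1 / 2) ^ r,
    mul_nonneg hC0 (tsum_nonneg fun r => by positivity), fun x hx B hB => ?_⟩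
  have hx0 : 0 < x := by linarith
  have hlogx : 1 / 2 ≤ Real.log x := by
    have := Real.log_le_log (by norm_num) hx
    linarith [Real.log_two_gt_d9]
  -- The dyadic level: `2 ^ r * x ≤ n j ≤ 2 ^ (r + 1) * x`.
  set r : (Fin k → ℕ) → ℕ := fun n => Nat.log 2 ⌊(n j : ℝ) / x⌋₊ with hr
  have hlow : ∀ n ∈ B, 2 ^ r n * x ≤ (n j : ℝ) := by
    intro n hn
    have h1 : 1 ≤ (n j : ℝ) / x := (one_le_div hx0).2 (hB n hn).le
    have h2 : ⌊(n j : ℝ) / x⌋₊ ≠ 0 := (Nat.floor_pos.2 h1).ne'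
    have h3 := Nat.pow_log_le_self 2 h2
    have h4 : ((2 ^ r n : ℕ) : ℝ) ≤ (n j : ℝ) / x :=
      (Nat.cast_le.2 h3).trans (Nat.floor_le (by positivity))
    rw [le_div_iff₀ hx0] at h4
    exact_mod_cast h4
  have hup : ∀ n ∈ B, (n j : ℝ) ≤ 2 ^ (r n + 1) * x := by
    intro n hn
    have h3 := Nat.lt_pow_succ_log_self (b := 2) (by norm_num) ⌊(n j : ℝ) / x⌋₊
    have h4 : (n j : ℝ) / x < ((2 ^ (r n + 1) : ℕ) : ℝ) :=
      (Nat.lt_floor_add_one _).trans_le (by exact_mod_cast h3)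
    rw [div_lt_iff₀ hx0] at h4
    exact_mod_cast h4.le
  have hfib : ∀ s ∈ B.image r, ∑ n ∈ B.filter (fun n => r n = s),
      |mobDelta G n| / ∏ i, (n i : ℝ)
        ≤ C * (((s : ℝ) + 4) ^ D * (1 / 2) ^ s) * (Real.log x ^ D / x) := by
    intro s _
    have hs : (1 : ℝ) ≤ 2 ^ (s + 1) * x := by
      have : (1 : ℝ) ≤ 2 ^ (s + 1) := one_le_pow₀ (by norm_num)
      nlinarith
    have h1 := hC (2 ^ (s + 1) * x) hs (B.filter (fun n => r n = s)) fun n hn => by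
      obtain ⟨hn', rfl⟩ := mem_filter.1 hn
      exact hup n hn'
    have h2 : ∑ n ∈ B.filter (fun n => r n = s), |mobDelta G n| / ∏ i, (n i : ℝ)
        ≤ ∑ n ∈ B.filter (fun n => r n = s),
          (|mobDelta G n| / ∏ i ∈ univ.erase j, (n i : ℝ)) * (1 / (2 ^ s * x)) := by
      refine Finset.sum_le_sum fun n hn => ?_
      obtain ⟨hn', rfl⟩ := mem_filter.1 hn
      rw [abs_div_prod_eq n j, div_eq_mul_one_div _ (n j : ℝ)]
      refine mul_le_mul_of_nonneg_left ?_ ?_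
      · exact one_div_le_one_div_of_le (by positivity) (hlow n hn')
      · exact div_nonneg (abs_nonneg _) (Finset.prod_nonneg fun i _ => by positivity)
    rw [← Finset.sum_mul] at h2
    -- Uses `1 ≤ 2 log x` and `log 2 ≤ log x`: the count is `2 + (s + 1) + 1 = s + 4`.
    have h3 : 1 + Real.log (2 ^ (s + 1) * x) ≤ ((s : ℝ) + 4) * Real.log x := by
      rw [Real.log_mul (by positivity) hx0.ne', Real.log_pow]
      have := Real.log_le_log (by norm_num) hx
      push_cast
      nlinarith
    have h4 : 0 ≤ 1 + Real.log (2 ^ (s + 1) * x) := by linarith [Real.log_nonneg hs]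
    calc _ ≤ _ := h2
      _ ≤ (C * (1 + Real.log (2 ^ (s + 1) * x)) ^ D) * (1 / (2 ^ s * x)) :=
          mul_le_mul_of_nonneg_right h1 (by positivity)
      _ ≤ (C * (((s : ℝ) + 4) * Real.log x) ^ D) * (1 / (2 ^ s * x)) := by gcongr
      _ = _ := by rw [mul_pow, one_div_pow]; field_simp
  rw [← Finset.sum_fiberwise_of_maps_to (fun n hn => mem_image_of_mem r hn)]
  refine (Finset.sum_le_sum hfib).trans ?_
  rw [← Finset.sum_mul, ← Finset.mul_sum]
  refine mul_le_mul_of_nonneg_right (mul_le_mul_of_nonneg_left ?_ hC0) ?_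
  · exact (summable_shift_pow_mul_half D).sum_le_tsum _ fun r _ => by positivity
  · exact div_nonneg (pow_nonneg (by linarith) _) hx0.le

lemma mobDelta_eq_zero_of_eq_zero {n : Fin k → ℕ} {i : Fin k} (h : n i = 0) :
    mobDelta G n = 0 :=
  mobDelta_of_not_squarefree G fun hs => (hs i).ne_zero h

/-- Cut at `n j = 2` for one coordinate `j`. Below the cut, dividing by `n j ≥ 1` only helps; above
it the tail bound applies. -/
lemma summable_mobDelta_div_prod (hk : 1 ≤ k) :
    Summable fun n : Fin k → ℕ => mobDelta G n / ∏ i, (n i : ℝ) := by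
  let j : Fin k := ⟨0, hk⟩
  obtain ⟨C1, -, h1⟩ := exists_sum_abs_mobDelta_le G j
  obtain ⟨C2, -, h2⟩ := exists_tail_le G j
  refine Summable.of_norm ?_
  have hnorm : ∀ n : Fin k → ℕ,
      ‖mobDelta G n / ∏ i, (n i : ℝ)‖ = |mobDelta G n| / ∏ i, (n i : ℝ) := by
    intro n
    rw [Real.norm_eq_abs, abs_div, abs_of_nonneg (a := ∏ i, (n i : ℝ))
      (Finset.prod_nonneg fun i _ => Nat.cast_nonneg _)]
  simp_rw [hnorm]
  refine summable_of_sum_le (c := C1 * (1 + Real.log 2) ^ G.maxDegree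
    + C2 * (Real.log 2 ^ G.maxDegree / 2))
    (fun n => div_nonneg (abs_nonneg _) (Finset.prod_nonneg fun i _ => Nat.cast_nonneg _)) ?_
  intro B
  rw [← Finset.sum_filter_add_sum_filter_not B (fun n => (n j : ℝ) ≤ 2)]
  refine add_le_add ?_ ?_
  · refine le_trans (Finset.sum_le_sum fun n _ => ?_)
      (h1 2 (by norm_num) _ fun n hn => (mem_filter.1 hn).2)
    rcases Nat.eq_zero_or_pos (n j) with h0 | h0
    · rw [mobDelta_eq_zero_of_eq_zero G h0]; simp
    · rw [abs_div_prod_eq n j]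
      refine div_le_self ?_ (by exact_mod_cast h0)
      exact div_nonneg (abs_nonneg _) (Finset.prod_nonneg fun i _ => Nat.cast_nonneg _)
  · exact h2 2 le_rfl _ fun n hn => not_le.1 (mem_filter.1 hn).2

/-! ### The asymptotic formula. -/

lemma sum_delta_box (x : ℝ) : ∑ n ∈ box k x, delta G n
    = ∑ d ∈ box k x, mobDelta G d * ∏ i, ((⌊x⌋₊ / d i : ℕ) : ℝ) := by
  have hmem : ∀ {n : Fin k → ℕ}, n ∈ box k x ↔ ∀ i, 1 ≤ n i ∧ n i ≤ ⌊x⌋₊ := by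
    intro n; simp [box, Fintype.mem_piFinset]
  have h1 : ∀ n ∈ box k x, delta G n
      = ∑ d ∈ Fintype.piFinset (fun i => (n i).divisors), mobDelta G d :=
    fun n hn => delta_eq_sum_mobDelta G fun i => by have := hmem.1 hn i; omega
  rw [Finset.sum_congr rfl h1, Finset.sum_comm'
    (s' := fun d => Fintype.piFinset (fun i => (Finset.Ioc 0 ⌊x⌋₊).filter (fun m => d i ∣ m)))
    (t' := box k x)]
  · refine Finset.sum_congr rfl fun d _ => ?_
    rw [Finset.sum_const, Fintype.card_piFinset, nsmul_eq_mul, mul_comm]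
    simp_rw [Nat.Ioc_filter_dvd_card_eq_div]
    push_cast
    rfl
  · intro n d
    simp only [hmem, Fintype.mem_piFinset, mem_filter, mem_Ioc, Nat.mem_divisors, ← forall_and]
    refine forall_congr' fun i => ?_
    constructor
    · rintro ⟨h, h', -⟩
      exact ⟨⟨⟨by omega, h.2⟩, h'⟩, Nat.pos_of_dvd_of_pos h' (by omega),
        (Nat.le_of_dvd (by omega) h').trans h.2⟩
    · rintro ⟨⟨h, h'⟩, -⟩
      exact ⟨⟨by omega, h.2⟩, h', by omega⟩

/-- Replacing each factor of a product by an approximation from below with error at most one. -/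
lemma abs_prod_sub_prod_le {ι : Type*} [DecidableEq ι] (s : Finset ι) (a b : ι → ℝ)
    (hb : ∀ i ∈ s, 0 ≤ b i) (hba : ∀ i ∈ s, b i ≤ a i) (hab : ∀ i ∈ s, a i - b i ≤ 1) :
    |∏ i ∈ s, b i - ∏ i ∈ s, a i| ≤ ∑ j ∈ s, ∏ i ∈ s.erase j, a i := by
  have hle : ∏ i ∈ s, b i ≤ ∏ i ∈ s, a i := Finset.prod_le_prod hb hba
  rw [abs_sub_comm, abs_of_nonneg (by linarith)]
  clear hle
  induction s using Finset.induction_on with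
  | empty => simp
  | insert j s hj ih =>
    have hb' : ∀ i ∈ s, 0 ≤ b i := fun i hi => hb i (mem_insert_of_mem hi)
    have hba' : ∀ i ∈ s, b i ≤ a i := fun i hi => hba i (mem_insert_of_mem hi)
    have hab' : ∀ i ∈ s, a i - b i ≤ 1 := fun i hi => hab i (mem_insert_of_mem hi)
    have ih' := ih hb' hba' hab'
    have h1 := hb j (mem_insert_self _ _)
    have h2 := hba j (mem_insert_self _ _)
    have h3 := hab j (mem_insert_self _ _)
    have hBn : 0 ≤ ∏ i ∈ s, b i := Finset.prod_nonneg hb'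
    have hBA : ∏ i ∈ s, b i ≤ ∏ i ∈ s, a i := Finset.prod_le_prod hb' hba'
    rw [Finset.prod_insert hj, Finset.prod_insert hj, Finset.sum_insert hj, erase_insert hj]
    have h4 : ∑ i ∈ s, ∏ l ∈ (insert j s).erase i, a l
        = a j * ∑ i ∈ s, ∏ l ∈ s.erase i, a l := by
      rw [Finset.mul_sum]
      refine Finset.sum_congr rfl fun i hi => ?_
      have hij : j ≠ i := fun h => hj (h ▸ hi)
      rw [erase_insert_of_ne hij, Finset.prod_insert (fun h => hj (mem_of_mem_erase h))]
    rw [h4]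
    -- Telescoping: with `A`, `B` the products over `s`, `a j * A - b j * B = a j * (A - B) + (a j -
    -- b j) * B`, and the last term is at most `A`.
    have h5 : a j * (∏ i ∈ s, a i - ∏ i ∈ s, b i) ≤ a j * ∑ i ∈ s, ∏ l ∈ s.erase i, a l :=
      mul_le_mul_of_nonneg_left ih' (h1.trans h2)
    nlinarith

lemma abs_floor_prod_sub_le {x : ℝ} (hx : 0 ≤ x) (d : Fin k → ℕ) :
    |∏ i, ((⌊x⌋₊ / d i : ℕ) : ℝ) - x ^ k / ∏ i, (d i : ℝ)|
      ≤ ∑ j, x ^ (k - 1) / ∏ i ∈ univ.erase j, (d i : ℝ) := by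
  have h := abs_prod_sub_prod_le univ (fun i => x / (d i : ℝ))
    (fun i => ((⌊x⌋₊ / d i : ℕ) : ℝ)) (fun i _ => Nat.cast_nonneg _)
    (fun i _ => by
      rw [← Nat.floor_div_natCast]
      exact Nat.floor_le (by positivity))
    (fun i _ => by
      rw [← Nat.floor_div_natCast]
      linarith [Nat.lt_floor_add_one (x / (d i : ℝ))])
  simp only [Finset.prod_div_distrib, Finset.prod_const, card_univ, Fintype.card_fin,
    card_erase_of_mem (mem_univ _)] at h
  exact h

lemma exists_main_estimate (hk : 1 ≤ k) : ∃ C : ℝ, ∀ x : ℝ, 2 ≤ x →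
    |∑ n ∈ box k x, delta G n - (∑' n : Fin k → ℕ, mobDelta G n / ∏ i, (n i : ℝ)) * x ^ k|
      ≤ C * (x ^ (k - 1) * Real.log x ^ G.maxDegree) := by
  classical
  choose C1 hC1 h1 using exists_sum_abs_mobDelta_le G
  choose C2 hC2 h2 using exists_tail_le G
  set D := G.maxDegree
  set F : (Fin k → ℕ) → ℝ := fun n => mobDelta G n / ∏ i, (n i : ℝ) with hF
  have hFs := summable_mobDelta_div_prod G hk
  -- The `3 ^ D` comes from `1 + log x ≤ 3 log x`, valid as `log x ≥ 1 / 2`; the second sum pays for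
  -- completing the series.
  refine ⟨(∑ j, C1 j) * 3 ^ D + ∑ j, C2 j, fun x hx => ?_⟩
  have hx0 : 0 < x := by linarith
  have hlogx : 1 / 2 ≤ Real.log x := by
    have := Real.log_le_log (by norm_num) hx
    linarith [Real.log_two_gt_d9]
  have hmem : ∀ {n : Fin k → ℕ}, n ∈ box k x ↔ ∀ i, 1 ≤ n i ∧ n i ≤ ⌊x⌋₊ := by
    intro n; simp [box, Fintype.mem_piFinset]
  have hA : |∑ n ∈ box k x, delta G n - (∑ n ∈ box k x, F n) * x ^ k|
      ≤ ((∑ j, C1 j) * 3 ^ D) * (x ^ (k - 1) * Real.log x ^ D) := by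
    rw [sum_delta_box, Finset.sum_mul, ← Finset.sum_sub_distrib]
    calc _ ≤ ∑ d ∈ box k x, |mobDelta G d * ∏ i, ((⌊x⌋₊ / d i : ℕ) : ℝ) - F d * x ^ k| :=
          Finset.abs_sum_le_sum_abs _ _
      _ ≤ ∑ d ∈ box k x, ∑ j, x ^ (k - 1) *
            (|mobDelta G d| / ∏ i ∈ univ.erase j, (d i : ℝ)) := by
          refine Finset.sum_le_sum fun d _ => ?_
          have h := abs_floor_prod_sub_le hx0.le d
          have e : mobDelta G d * ∏ i, ((⌊x⌋₊ / d i : ℕ) : ℝ) - F d * x ^ k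
              = mobDelta G d * (∏ i, ((⌊x⌋₊ / d i : ℕ) : ℝ) - x ^ k / ∏ i, (d i : ℝ)) := by
            simp only [hF]; ring
          rw [e, abs_mul]
          refine (mul_le_mul_of_nonneg_left h (abs_nonneg _)).trans_eq ?_
          rw [Finset.mul_sum]
          exact Finset.sum_congr rfl fun j _ => by ring
      _ = ∑ j, x ^ (k - 1) *
            ∑ d ∈ box k x, |mobDelta G d| / ∏ i ∈ univ.erase j, (d i : ℝ) := by
          rw [Finset.sum_comm]
          simp_rw [Finset.mul_sum]
      _ ≤ ∑ j, x ^ (k - 1) * (C1 j * (3 ^ D * Real.log x ^ D)) := by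
          refine Finset.sum_le_sum fun j _ => mul_le_mul_of_nonneg_left ?_ (by positivity)
          refine (h1 j x (by linarith) (box k x) fun d hd => ?_).trans ?_
          · exact (Nat.cast_le.2 (hmem.1 hd j).2).trans (Nat.floor_le hx0.le)
          · rw [← mul_pow]
            refine mul_le_mul_of_nonneg_left (pow_le_pow_left₀ (by linarith) (by linarith) _)
              (hC1 j)
      _ = _ := by
          rw [← Finset.mul_sum, ← Finset.sum_mul]; ring
  have hB : |(∑ n ∈ box k x, F n) - ∑' n, F n| ≤ (∑ j, C2 j) * (Real.log x ^ D / x) := by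
    have hlim : Tendsto (fun B : Finset (Fin k → ℕ) => |(∑ n ∈ box k x, F n) - ∑ n ∈ B, F n|)
        atTop (𝓝 |(∑ n ∈ box k x, F n) - ∑' n, F n|) :=
      (tendsto_const_nhds.sub hFs.hasSum).abs
    refine le_of_tendsto hlim ?_
    filter_upwards [eventually_ge_atTop (box k x)] with B hBx
    rw [abs_sub_comm, ← Finset.sum_sdiff hBx, add_sub_cancel_right]
    -- A tuple of positive integers outside the box has some component exceeding `x`; tuples with a
    -- zero component contribute nothing.
    have hcov : ∀ n ∈ B \ box k x, |F n| ≤ ∑ j, if x < (n j : ℝ) then |F n| else 0 := by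
      intro n hn
      have hnn : ∀ j ∈ univ, 0 ≤ if x < (n j : ℝ) then |F n| else 0 := by
        intro j _; split_ifs <;> positivity
      by_cases h0 : ∃ i, n i = 0
      · obtain ⟨i, hi⟩ := h0
        have : F n = 0 := by simp only [hF, mobDelta_eq_zero_of_eq_zero G hi, zero_div]
        rw [this]; simp
      · push Not at h0
        have hnb := (mem_sdiff.1 hn).2
        rw [hmem] at hnb
        push Not at hnb
        obtain ⟨j, hj⟩ := hnb
        have hlt : x < (n j : ℝ) :=
          (Nat.floor_lt hx0.le).1 (hj (Nat.one_le_iff_ne_zero.2 (h0 j)))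
        refine le_trans ?_ (Finset.single_le_sum hnn (mem_univ j))
        rw [if_pos hlt]
    calc |∑ n ∈ B \ box k x, F n| ≤ ∑ n ∈ B \ box k x, |F n| := Finset.abs_sum_le_sum_abs _ _
      _ ≤ ∑ n ∈ B \ box k x, ∑ j, if x < (n j : ℝ) then |F n| else 0 :=
          Finset.sum_le_sum hcov
      _ = ∑ j, ∑ n ∈ (B \ box k x).filter (fun n => x < (n j : ℝ)), |F n| := by
          rw [Finset.sum_comm]
          simp_rw [Finset.sum_filter]
      _ ≤ ∑ j, C2 j * (Real.log x ^ D / x) := by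
          refine Finset.sum_le_sum fun j _ => ?_
          have := h2 j x hx ((B \ box k x).filter (fun n => x < (n j : ℝ)))
            fun n hn => (mem_filter.1 hn).2
          refine le_trans (Finset.sum_le_sum fun n _ => ?_) this
          simp only [hF]
          rw [abs_div, abs_of_nonneg (a := ∏ i, (n i : ℝ))
            (Finset.prod_nonneg fun i _ => Nat.cast_nonneg _)]
      _ = _ := by rw [Finset.sum_mul]
  have hxk : x ^ k = x ^ (k - 1) * x := by rw [← pow_succ, Nat.sub_add_cancel hk]
  calc _ = |(∑ n ∈ box k x, delta G n - (∑ n ∈ box k x, F n) * x ^ k)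
          + ((∑ n ∈ box k x, F n) - ∑' n, F n) * x ^ k| := by congr 1; ring
    _ ≤ _ + _ := abs_add_le _ _
    _ ≤ ((∑ j, C1 j) * 3 ^ D) * (x ^ (k - 1) * Real.log x ^ D)
          + (∑ j, C2 j) * (Real.log x ^ D / x) * x ^ k := by
        refine add_le_add hA ?_
        rw [abs_mul, abs_of_pos (pow_pos hx0 k)]
        exact mul_le_mul_of_nonneg_right hB (by positivity)
    _ = _ := by
        rw [hxk]; field_simp

/-! ### The Euler product. -/

lemma prod_primes_sum_coef (P : Finset ℕ) (hP : ∀ p ∈ P, p.Prime) :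
    ∏ p ∈ P, ∑ S : Finset (Fin k), coef G S * (1 / (p : ℝ)) ^ S.card
      = ∑ d ∈ Fintype.piFinset (fun _ : Fin k => (∏ p ∈ P, p).divisors),
          mobDelta G d / ∏ i, (d i : ℝ) := by
  classical
  have hN : ∏ p ∈ P, p ≠ 0 := Finset.prod_ne_zero_iff.2 fun p hp => (hP p hp).ne_zero
  have hpf : (∏ p ∈ P, p).primeFactors = P := primeFactors_prod_primes P hP
  have h := prod_sum_powerset_dvdSet (k := k) (fun _ => ∏ p ∈ P, p) (fun _ => hN) P hP
    (fun _ => hpf.subset) (fun p S => coef G S * (1 / (p : ℝ)) ^ S.card)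
  have huniv : ∀ p ∈ P, dvdSet (fun _ : Fin k => ∏ p ∈ P, p) p = univ := by
    intro p hp
    ext i
    simpa using dvd_prod_of_mem (fun p => p) hp
  rw [Finset.prod_congr rfl fun p hp => by rw [← Finset.powerset_univ, ← huniv p hp], h,
    Finset.sum_filter]
  refine Finset.sum_congr rfl fun d hd => ?_
  simp only [Fintype.mem_piFinset, Nat.mem_divisors] at hd
  split_ifs with hs
  · have hnP : ∀ i, (d i).primeFactors ⊆ P := fun i =>
      (Nat.primeFactors_mono (hd i).1 hN).trans hpf.subset
    rw [mobDelta_eq G hs hP hnP, ← prod_pow_card_dvd hs hP hnP, ← Finset.prod_div_distrib]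
    refine Finset.prod_congr rfl fun p _ => ?_
    rw [one_div_pow, mul_one_div]
    rfl
  · rw [mobDelta_of_not_squarefree G hs, zero_div]

/-- The Euler product of the multiple series of `mobDelta`. -/
lemma hasProd_sum_coef (hk : 1 ≤ k) :
    HasProd (fun p : Nat.Primes => ∑ S : Finset (Fin k), coef G S * (1 / (p : ℝ)) ^ S.card)
      (∑' n : Fin k → ℕ, mobDelta G n / ∏ i, (n i : ℝ)) := by
  classical
  set F : (Fin k → ℕ) → ℝ := fun n => mobDelta G n / ∏ i, (n i : ℝ) with hF
  let sq : Set (Fin k → ℕ) := {n | ∀ i, Squarefree (n i)}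
  have hsupp : Function.support F ⊆ sq := by
    intro n hn
    by_contra h
    exact hn (by simp only [hF, mobDelta_of_not_squarefree G h, zero_div])
  have hsum : HasSum (F ∘ ((↑) : sq → Fin k → ℕ)) (∑' n, F n) :=
    (hasSum_subtype_iff_of_support_subset hsupp).2 (summable_mobDelta_div_prod G hk).hasSum
  let N : Finset Nat.Primes → ℕ := fun T => ∏ p ∈ T, (p : ℕ)
  have hN0 : ∀ T, N T ≠ 0 := fun T => Finset.prod_ne_zero_iff.2 fun p _ => p.2.ne_zero
  let s : Finset Nat.Primes → Finset sq := fun T =>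
    (Fintype.piFinset (fun _ : Fin k => (N T).divisors)).subtype (· ∈ sq)
  -- Squarefree tuples of divisors of `∏ T` exhaust all squarefree tuples as `T` grows, so the
  -- finite products are partial sums along a cofinal family.
  have hs : Tendsto s atTop atTop := by
    refine tendsto_atTop_finset_of_monotone ?_ ?_
    · intro T U hTU n hn
      simp only [s, mem_subtype, Fintype.mem_piFinset, Nat.mem_divisors] at hn ⊢
      exact fun i => ⟨(hn i).1.trans (Finset.prod_dvd_prod_of_subset _ _ _ hTU), hN0 U⟩
    · rintro ⟨n, hn⟩
      refine ⟨(∏ i, n i).primeFactors.subtype Nat.Prime, ?_⟩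
      simp only [s, mem_subtype, Fintype.mem_piFinset, Nat.mem_divisors]
      refine fun i => ⟨?_, hN0 _⟩
      rw [← Nat.prod_primeFactors_of_squarefree (hn i)]
      refine Finset.prod_primes_dvd _ (fun p hp => (Nat.prime_of_mem_primeFactors hp).prime)
        fun p hp => ?_
      refine dvd_prod_of_mem (fun p : Nat.Primes => (p : ℕ))
        (a := ⟨p, Nat.prime_of_mem_primeFactors hp⟩) ?_
      exact mem_subtype.2 (primeFactors_subset_prod (fun i => (hn i).ne_zero) i hp)
  have hlim := Tendsto.comp (show Tendsto _ _ _ from hsum) hs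
  show Tendsto _ _ _
  refine Tendsto.congr' ?_ hlim
  refine Eventually.of_forall fun T => ?_
  let e : Nat.Primes ↪ ℕ := ⟨fun p => p, Subtype.val_injective⟩
  have h1 := prod_primes_sum_coef G (T.map e) (by
    intro p hp
    obtain ⟨q, -, rfl⟩ := mem_map.1 hp
    exact q.2)
  rw [Finset.prod_map, Finset.prod_map] at h1
  refine Eq.trans ?_ h1.symm
  simp only [Function.comp_apply, s]
  rw [Finset.sum_subtype_eq_sum_filter (f := F), Finset.sum_filter]
  refine Finset.sum_congr rfl fun n _ => ?_
  split_ifs with h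
  · rfl
  · simp only [mobDelta_of_not_squarefree G h, zero_div]

/-! ### The local series at a prime. -/

/-- Nonnegativity allows each finite sum to be enlarged to a box, where it factors; the value is
then read off along cubes. -/
lemma hasSum_pi_prod {ι : Type*} [Fintype ι] (f : ι → ℕ → ℝ) (hf : ∀ i m, 0 ≤ f i m)
    (a : ι → ℝ) (ha : ∀ i, HasSum (f i) (a i)) :
    HasSum (fun ν : ι → ℕ => ∏ i, f i (ν i)) (∏ i, a i) := by
  classical
  have hnn : ∀ ν : ι → ℕ, 0 ≤ ∏ i, f i (ν i) := fun ν => Finset.prod_nonneg fun i _ => hf i _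
  have hs : Summable fun ν : ι → ℕ => ∏ i, f i (ν i) := by
    refine summable_of_sum_le (c := ∏ i, a i) hnn fun B => ?_
    calc ∑ ν ∈ B, ∏ i, f i (ν i)
        ≤ ∑ ν ∈ Fintype.piFinset (fun i => B.image (fun ν => ν i)), ∏ i, f i (ν i) := by
          refine Finset.sum_le_sum_of_subset_of_nonneg (fun ν hν => ?_) fun ν _ _ => hnn ν
          exact Fintype.mem_piFinset.2 fun i => mem_image_of_mem (fun ν : ι → ℕ => ν i) hν
      _ = ∏ i, ∑ m ∈ B.image (fun ν => ν i), f i m := (Finset.prod_univ_sum _ _).symm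
      _ ≤ ∏ i, a i := by
          refine Finset.prod_le_prod (fun i _ => Finset.sum_nonneg fun m _ => hf i m) fun i _ => ?_
          exact sum_le_hasSum _ (fun m _ => hf i m) (ha i)
  have h1 : Tendsto (fun N : ℕ => Fintype.piFinset (fun _ : ι => Finset.range N)) atTop atTop := by
    refine tendsto_atTop_finset_of_monotone ?_ fun ν => ⟨∑ i, ν i + 1, ?_⟩
    · exact fun M N h => Fintype.piFinset_subset _ _ fun _ => range_mono h
    · refine Fintype.mem_piFinset.2 fun i => mem_range.2 (Nat.lt_succ_of_le ?_)
      exact Finset.single_le_sum (f := ν) (fun _ _ => Nat.zero_le _) (mem_univ i)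
  have h2 := Tendsto.comp (show Tendsto _ _ _ from hs.hasSum) h1
  have h3 : Tendsto (fun N : ℕ => ∏ i, ∑ m ∈ Finset.range N, f i m) atTop (𝓝 (∏ i, a i)) :=
    tendsto_finsetProd _ fun i _ => (ha i).tendsto_sum_nat
  have h4 : (fun N : ℕ => ∏ i, ∑ m ∈ Finset.range N, f i m)
      = (fun B : Finset (ι → ℕ) => ∑ ν ∈ B, ∏ i, f i (ν i)) ∘
        fun N : ℕ => Fintype.piFinset (fun _ : ι => Finset.range N) := by
    funext N
    exact Finset.prod_univ_sum _ _
  rw [h4] at h3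
  rw [← tendsto_nhds_unique h2 h3]
  exact hs.hasSum

lemma delta_prime_pow {p : ℕ} (hp : p.Prime) (ν : Fin k → ℕ) :
    delta G (fun i => p ^ ν i) = ind G (univ.filter fun i => ν i ≠ 0) := by
  have hg : ∀ a b : ℕ, Nat.gcd (p ^ a) (p ^ b) = 1 ↔ a = 0 ∨ b = 0 := by
    intro a b
    constructor
    · intro h
      by_contra! hne
      have := Nat.dvd_gcd (dvd_pow_self p hne.1) (dvd_pow_self p hne.2)
      rw [h] at this
      exact hp.one_lt.ne' (Nat.dvd_one.1 this)
    · rintro (rfl | rfl) <;> simp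
  unfold delta ind
  refine if_congr ?_ rfl rfl
  constructor
  · intro h i hi j hj _ hadj
    have := (hg _ _).1 (h i j hadj)
    simp only [coe_filter, mem_univ, true_and, Set.mem_ofPred_eq] at hi hj
    tauto
  · intro h i j hadj
    rw [hg]
    by_contra! hne
    exact h (by simpa using hne.1) (by simpa using hne.2) hadj.ne hadj

/-- The local series at a prime. -/
lemma hasSum_delta_prime_pow {p : ℕ} (hp : p.Prime) :
    HasSum (fun ν : Fin k → ℕ => delta G (fun i => p ^ ν i) / (p : ℝ) ^ (∑ i, ν i))
      (∑ I : Finset (Fin k), ind G I *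
        ∏ i, if i ∈ I then (1 - 1 / (p : ℝ))⁻¹ - 1 else 1) := by
  set q : ℝ := 1 / (p : ℝ) with hq
  have hp2 : (2 : ℝ) ≤ p := by exact_mod_cast hp.two_le
  have hq0 : 0 ≤ q := by positivity
  have hq1 : q < 1 := by rw [hq, div_lt_one (by linarith)]; linarith
  have hzero : HasSum (fun m : ℕ => if m = 0 then (1 : ℝ) else 0) 1 := hasSum_ite_eq 0 1
  -- The exponent tuples with support exactly `I`: a geometric series without its zeroth term for `i
  -- ∈ I`, and the single term 1 otherwise.
  have h1 : ∀ I : Finset (Fin k), HasSum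
      (fun ν : Fin k → ℕ => ∏ i, if (i ∈ I ↔ ν i ≠ 0) then q ^ ν i else 0)
      (∏ i, if i ∈ I then (1 - q)⁻¹ - 1 else 1) := by
    intro I
    refine hasSum_pi_prod (fun i m => if (i ∈ I ↔ m ≠ 0) then q ^ m else 0)
      (fun i m => ?_) _ fun i => ?_
    · split_ifs <;> positivity
    · by_cases hi : i ∈ I
      · rw [if_pos hi]
        refine ((hasSum_geometric_of_lt_one hq0 hq1).sub hzero).congr_fun fun m => ?_
        by_cases hm : m = 0 <;> simp [hi, hm]
      · rw [if_neg hi]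
        refine hzero.congr_fun fun m => ?_
        by_cases hm : m = 0 <;> simp [hi, hm]
  have h2 := hasSum_sum (s := univ) fun I _ => (h1 I).mul_left (ind G I)
  refine h2.congr_fun fun ν => ?_
  rw [delta_prime_pow G hp, Finset.sum_eq_single (univ.filter fun i => ν i ≠ 0)]
  · have : ∀ i, (i ∈ univ.filter fun i => ν i ≠ 0) ↔ ν i ≠ 0 := fun i => by simp
    simp only [this, if_true]
    rw [Finset.prod_pow_eq_pow_sum, hq, one_div_pow, mul_one_div]
  · intro I _ hI
    have : ∃ i, ¬ (i ∈ I ↔ ν i ≠ 0) := by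
      by_contra! h
      exact hI (by ext i; simpa using h i)
    obtain ⟨i, hi⟩ := this
    rw [Finset.prod_eq_zero (mem_univ i) (if_neg hi), mul_zero]
  · simp

lemma local_factor_eq {p : ℕ} (hp : p.Prime) :
    (1 - 1 / (p : ℝ)) ^ k *
        ∑' ν : Fin k → ℕ, delta G (fun i => p ^ ν i) / (p : ℝ) ^ (∑ i, ν i)
      = ∑ S : Finset (Fin k), coef G S * (1 / (p : ℝ)) ^ S.card := by
  rw [(hasSum_delta_prime_pow G hp).tsum_eq, sum_coef_mul_pow, Finset.mul_sum]
  refine Finset.sum_congr rfl fun I _ => ?_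
  have hp2 : (2 : ℝ) ≤ p := by exact_mod_cast hp.two_le
  set q : ℝ := 1 / (p : ℝ) with hq
  have hq1 : q < 1 := by rw [hq, div_lt_one (by linarith)]; linarith
  have hne : 1 - q ≠ 0 := by linarith
  have hI : I.card ≤ k := by simpa using card_le_univ I
  have e : (1 - q) ^ k = (1 - q) ^ (k - I.card) * (1 - q) ^ I.card := by
    rw [← pow_add, Nat.sub_add_cancel hI]
  -- Each vertex of `I` uses one factor `1 - q` to become `q`; the remaining `k - I.card` factors
  -- survive.
  have e2 : (1 - q) * ((1 - q)⁻¹ - 1) = q := by field_simp; ring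
  rw [← Finset.prod_filter, Finset.prod_const, filter_mem_eq_inter, univ_inter, e]
  calc _ = ind G I * (((1 - q) * ((1 - q)⁻¹ - 1)) ^ I.card * (1 - q) ^ (k - I.card)) := by
        rw [mul_pow]; ring
    _ = _ := by rw [e2]

lemma hasSum_conv_div_prod (hk : 1 ≤ k) :
    HasSum (fun n : Fin k → ℕ+ => conv mobius (delta G) (fun i => (n i : ℕ)) / ∏ i, (n i : ℝ))
      (∑' n : Fin k → ℕ, mobDelta G n / ∏ i, (n i : ℝ)) := by
  have hinj : Function.Injective (fun (n : Fin k → ℕ+) (i : Fin k) => (n i : ℕ)) :=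
    fun m n h => funext fun i => PNat.coe_injective (congrFun h i)
  refine ((hinj.hasSum_iff ?_).2 (summable_mobDelta_div_prod G hk).hasSum).congr_fun fun n => ?_
  · intro n hn
    have : ∃ i, n i = 0 := by
      by_contra! h
      exact hn ⟨fun i => ⟨n i, Nat.pos_of_ne_zero (h i)⟩, rfl⟩
    obtain ⟨i, hi⟩ := this
    rw [mobDelta_eq_zero_of_eq_zero G hi, zero_div]
  · simp only [Function.comp_apply]
    rw [conv_mobius_delta G fun i => (n i).ne_zero]

end CoprimalityGraph

theorem theorem5 (k : ℕ) (hk : 1 ≤ k) (G : SimpleGraph (Fin k)) [DecidableRel G.Adj] :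
    ∃ A : ℝ,
      (∃ C : ℝ, ∀ x : ℝ, 2 ≤ x →
        |∑ n ∈ CoprimalityGraph.box k x, CoprimalityGraph.delta G n - A * x ^ k|
          ≤ C * (x ^ (k - 1) * Real.log x ^ G.maxDegree)) ∧
      HasSum (fun n : Fin k → ℕ+ =>
        CoprimalityGraph.conv CoprimalityGraph.mobius (CoprimalityGraph.delta G)
          (fun i => (n i : ℕ)) / ∏ i, (n i : ℝ)) A ∧
      (∀ p : Nat.Primes, Summable (fun ν : Fin k → ℕ =>
        CoprimalityGraph.delta G (fun i => (p : ℕ) ^ ν i) / (p : ℝ) ^ (∑ i, ν i))) ∧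
      HasProd (fun p : Nat.Primes =>
        (1 - 1 / (p : ℝ)) ^ k *
          ∑' ν : Fin k → ℕ,
            CoprimalityGraph.delta G (fun i => (p : ℕ) ^ ν i) / (p : ℝ) ^ (∑ i, ν i)) A ∧
      ∀ J : Finset (Fin k), G.IsVertexCover (J : Set (Fin k)) →
        HasProd (fun p : Nat.Primes =>
          ∑ L ∈ CoprimalityGraph.indepSubsets G J,
            1 / (p : ℝ) ^ L.card *
              (1 - 1 / (p : ℝ)) ^ ((J \ L).card + (CoprimalityGraph.nbhd G L \ J).card)) A := by
  refine ⟨∑' n : Fin k → ℕ, CoprimalityGraph.mobDelta G n / ∏ i, (n i : ℝ),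
    CoprimalityGraph.exists_main_estimate G hk, CoprimalityGraph.hasSum_conv_div_prod G hk,
    fun p => (CoprimalityGraph.hasSum_delta_prime_pow G p.2).summable, ?_, fun J hJ => ?_⟩
  · convert CoprimalityGraph.hasProd_sum_coef G hk using 2 with p
    exact CoprimalityGraph.local_factor_eq G p.2
  · convert CoprimalityGraph.hasProd_sum_coef G hk using 2 with p
    rw [CoprimalityGraph.sum_coef_mul_pow,
      CoprimalityGraph.sum_ind_eq_sum_indepSubsets G _ J hJ]
    exact Finset.sum_congr rfl fun L _ => by rw [one_div_pow]
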